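/- **Rank Theorem for Lipschitz mappings.** Norms on $\mathbb R^n$ and $\mathbb R^m$ are Euclidean, matrices carry the corresponding operator norm, $\mathbf B_s(a)$ is the open ball, and $\mathcal B_{m\times n}$ is the closed unit ball of real $m\times n$ matrices. For a mapping $h$ into a Euclidean space, "$L(h)\le c$ on $S$" means $\|h(x)-h(y)\|\le c\|x-y\|$ for all $x,y\in S$. For $f:\mathbb R^n\to\mathbb R^m$, the generalized Jacobian $\partial f(x)$ is the convex hull of all matrices $\lim_{i\to\infty} Jf(x_i)$, where $x_i\to x$ and $f$ is differentiable at every $x_i$, with Jacobian matrix $Jf(x_i)$. For $p\le\min(m,n)$, $\partial_{p\times p}f(x)$ is the set of upper-left $p\times p$ blocks of the matrices in $\partial f(x)$. A set of matrices is *of rank $p$* if each of its members has rank $p$. Let $p\le\min(m,n)$, let $f:\mathbb R^n\to\mathbb R^m$, let $U$ be a neighborhood of $x_0\in\mathbb R^n$, and let $K>0$ with $L(f)\le K$ on $U$. Suppose that $\partial f(x)$ is of rank $p$ for all $x\in U$ and that $\partial_{p\times p}f(x_0)$ is of rank $p$. Set $$\delta=\frac12\inf_{M_1\in\partial_{p\times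 p}f(x_0)}\frac1{\bigl(1+(1+K)^2\|M_1^{-1}\|^2\bigr)^{1/2}},$$ and let $r>0$ be such that $\mathbf B_r(x_0)\subset U$ and $$\partial f(x)\subset\partial f(x_0)+\delta\,\mathcal B_{m\times n}\quad\text{for all }x\in\mathbf B_r(x_0).$$ Put $\rho_1=\dfrac{r\delta}{2(K+1)}$ and $\rho_2=\dfrac{r\delta}2$. Then there exist - an open set $D$ with $\mathbf B_{\rho_1}(x_0)\subset D\subset\mathbf B_r(x_0)$ and a homeomorphism $\varphi$ from $D$ onto the ball $\mathbf B_{\rho_2}(\varphi(x_0))\subset\mathbb R^n$, with $L(\varphi)\le K+1$ on $D$ and $L(\varphi^{-1})\le\frac1\delta$ on $\mathbf B_{\rho_2}(\varphi(x_0))$; - an open set $W\subset\mathbb R^m$ containing $\mathbf B_{\rho_2}(f(x_0))$ and $f(D)$, and a homeomorphism $\psi$ from $W$ onto an open subset of $\mathbb R^m$, with $L(\psi)\le1+\frac K\delta$ on $W$ and with $\psi^{-1}$ Lipschitz on $\psi(W)$; such that for all $z=(z_1,\dots,z_n)\in\mathbf B_{\rho_2}(\varphi(x_0))$ $$\psi\circ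 f\circ\varphi^{-1}(z_1,\dots,z_n)=(z_1,\dots,z_p,0,\dots,0)\in\mathbb R^m .$$ In particular $\varphi$ is a bi-Lipschitz homeomorphism from $\mathbf B_{\rho_1}(x_0)$ onto its image, and $\psi$ is one from $\mathbf B_{\rho_2}(f(x_0))$ onto its image. -/

import Mathlib

open Filter Topology Set Metric
open scoped Pointwise Matrix.Norms.L2Operator

noncomputable section

namespace LipschitzRank

/-- `L(f) ≤ c` on the set `S`, for the Euclidean norms. -/
def LipBound {a b : ℕ} (f : EuclideanSpace ℝ (Fin a) → EuclideanSpace ℝ (Fin b))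
    (S : Set (EuclideanSpace ℝ (Fin a))) (c : ℝ) : Prop :=
  ∀ x ∈ S, ∀ y ∈ S, ‖f x - f y‖ ≤ c * ‖x - y‖

/-- The Jacobian matrix of `f` at `x` (meaningful where `f` is differentiable). -/
def jacobian {n m : ℕ} (f : EuclideanSpace ℝ (Fin n) → EuclideanSpace ℝ (Fin m))
    (x : EuclideanSpace ℝ (Fin n)) : Matrix (Fin m) (Fin n) ℝ :=
  Matrix.of fun i j => fderiv ℝ f x (EuclideanSpace.single j 1) i

/-- The generalized Jacobian of `f` at `x₀`: the convex hull of all limits of Jacobian matrices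
`Jf(xᵢ)` along sequences `xᵢ → x₀` of points at which `f` is differentiable. -/
def genJacobian {n m : ℕ} (f : EuclideanSpace ℝ (Fin n) → EuclideanSpace ℝ (Fin m))
    (x₀ : EuclideanSpace ℝ (Fin n)) : Set (Matrix (Fin m) (Fin n) ℝ) :=
  convexHull ℝ {M | ∃ x : ℕ → EuclideanSpace ℝ (Fin n), Tendsto x atTop (𝓝 x₀) ∧
    (∀ i, DifferentiableAt ℝ f (x i)) ∧
    Tendsto (fun i => jacobian f (x i)) atTop (𝓝 M)}

/-- The set of upper-left `p × p` blocks of the matrices in the generalized Jacobian. -/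
def genJacobianBlock {n m p : ℕ} (hpn : p ≤ n) (hpm : p ≤ m)
    (f : EuclideanSpace ℝ (Fin n) → EuclideanSpace ℝ (Fin m))
    (x₀ : EuclideanSpace ℝ (Fin n)) : Set (Matrix (Fin p) (Fin p) ℝ) :=
  (fun M => M.submatrix (Fin.castLE hpm) (Fin.castLE hpn)) '' genJacobian f x₀

/-- A set of matrices is of rank `p` if each of its members has rank `p`. -/
def OfRank {a b : ℕ} (S : Set (Matrix (Fin a) (Fin b) ℝ)) (p : ℕ) : Prop :=
  ∀ M ∈ S, M.rank = p

/-- `½ inf (1 + (1 + K)² ‖M₁⁻¹‖²)^(-1/2)` over the matrices `M₁` of a set `S`,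
with the operator norm for the Euclidean norms. -/
def blockDelta {p : ℕ} (S : Set (Matrix (Fin p) (Fin p) ℝ)) (K : ℝ) : ℝ :=
  1 / 2 * sInf ((fun M₁ => 1 / Real.sqrt (1 + (1 + K) ^ 2 * ‖M₁⁻¹‖ ^ 2)) '' S)

end LipschitzRank

end

/-! Let φ consist of the first p components of f followed by the last n − p coordinates of the
source (`straighten`). Where f is differentiable, Dφ has block form [[M₁, M₂], [0, I]], with M₁, M₂
taken from the upper rows of Jf. Completing the matrices of the generalized Jacobian at x₀ in this
way gives a convex set S whose members A all satisfy ‖Av‖ ≥ 2δ‖v‖ (`norm_le_mul_norm_complete`), and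
almost everywhere on the ball Dφ lies within δ of S.

Convexity replaces continuity of the derivative. For fixed v, one unit vector w has ⟨w, Av⟩ ≥ 2δ‖v‖
for every A in S, hence ⟨w, Dφ v⟩ ≥ δ‖v‖ almost everywhere. Integrating along segments gives the
lower Lipschitz bound for φ (`mul_norm_sub_le_of_fderiv_near`); the same argument with adjoints, at
a minimizer of ‖y − φ x‖, shows that φ covers the ball of radius ρ₂
(`ball_subset_image_of_fderiv_near`).

The map F = f ∘ φ⁻¹ preserves the first p coordinates. As Df has rank p, DF almost everywhere kills
the other directions, so F depends on the first p coordinates only (`eq_of_res_eq`). Its image is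
then a Lipschitz graph, which the shear ψ flattens (`exists_shear`). -/

namespace LipschitzRank

/-! ### Mean value inequality, separation and convex hulls -/

open MeasureTheory in
/-- Mean value inequality for Lipschitz functions, with an almost everywhere bound on the
directional derivative. -/
theorem le_sub_of_ae_le_fderiv {E : Type*} [NormedAddCommGroup E] [NormedSpace ℝ E]
    [FiniteDimensional ℝ E] [MeasurableSpace E] [BorelSpace E] (μ : Measure E)
    [μ.IsAddHaarMeasure] {B : Set E} (hBo : IsOpen B) (hBc : Convex ℝ B) {C : NNReal}
    {g : E → ℝ} (hg : LipschitzOnWith C g B) {v : E} {c : ℝ}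
    (h : ∀ᵐ x ∂μ, x ∈ B → DifferentiableAt ℝ g x → c ≤ fderiv ℝ g x v)
    {x : E} (hx : x ∈ B) (hxv : x + v ∈ B) : c ≤ g (x + v) - g x := by
  have h1 : ∀ᵐ x ∂μ, x ∈ B → DifferentiableAt ℝ g x ∧ c ≤ fderiv ℝ g x v := by
    filter_upwards [h, hg.ae_differentiableWithinAt_of_mem (μ := μ)] with y hy hd hyB
    have hd' := (hd hyB).differentiableAt (hBo.mem_nhds hyB)
    exact ⟨hd', hy hyB hd'⟩
  -- The exceptional set is enlarged to a measurable null set, so that Fubini applies.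
  set N : Set E := toMeasurable μ {x | ¬ (x ∈ B → DifferentiableAt ℝ g x ∧ c ≤ fderiv ℝ g x v)}
    with hN
  have hN0 : μ N = 0 := by
    rw [hN, measure_toMeasurable]; exact h1
  have hNm : MeasurableSet N := measurableSet_toMeasurable _ _
  have hNs : ∀ y, y ∉ N → y ∈ B → DifferentiableAt ℝ g y ∧ c ≤ fderiv ℝ g y v := by
    intro y hy
    by_contra hcon
    exact hy (subset_toMeasurable _ _ hcon)
  -- Each translate of N is null, so by Fubini almost every line parallel to v meets N in a null set
  -- of parameters. On such a line g is absolutely continuous and the fundamental theorem of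
  -- calculus applies.
  have h2 : ∀ᵐ t : ℝ, ∀ᵐ x ∂μ, x + t • v ∉ N := by
    refine Eventually.of_forall fun t => ?_
    exact (measurePreserving_add_right μ (t • v)).quasiMeasurePreserving.ae
      (p := fun y => y ∉ N) (measure_eq_zero_iff_ae_notMem.1 hN0)
  have h3 : ∀ᵐ x ∂μ, ∀ᵐ t : ℝ, x + t • v ∉ N := by
    refine (Measure.ae_ae_comm ?_).1 h2
    have : Measurable fun q : ℝ × E => q.2 + q.1 • v := by fun_prop
    exact (this hNm).compl
  have h4 : ∀ y, (∀ᵐ t : ℝ, y + t • v ∉ N) → y ∈ B → y + v ∈ B → c ≤ g (y + v) - g y := by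
    intro y hy hyB hyvB
    have hseg : ∀ t ∈ Icc (0 : ℝ) 1, y + t • v ∈ B := fun t ht => by
      simpa using hBc.add_smul_sub_mem hyB hyvB ht
    have hlip : LipschitzOnWith (C * ‖v‖₊) (fun t : ℝ => g (y + t • v)) (uIcc 0 1) := by
      rw [uIcc_of_le zero_le_one]
      refine hg.comp (f := fun t : ℝ => y + t • v) ?_ hseg
      refine LipschitzOnWith.of_dist_le_mul fun s _ t _ => ?_
      rw [dist_add_left, dist_eq_norm, ← sub_smul, norm_smul, Real.dist_eq, mul_comm]
      rfl
    have hac := hlip.absolutelyContinuousOnInterval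
    have hint := hac.integral_deriv_eq_sub
    have hmono : ∫ _ in (0 : ℝ)..1, c ≤ ∫ t in (0 : ℝ)..1, deriv (fun t : ℝ => g (y + t • v)) t := by
      refine intervalIntegral.integral_mono_ae_restrict zero_le_one
        (by simp) hac.intervalIntegrable_deriv ?_
      refine (ae_restrict_iff' measurableSet_Icc).2 ?_
      filter_upwards [hy] with t ht htI
      obtain ⟨hd, hc⟩ := hNs _ ht (hseg t htI)
      have hder : HasDerivAt (fun t : ℝ => y + t • v) v t := by
        simpa using ((hasDerivAt_id t).smul_const v).const_add y
      have := hd.hasFDerivAt.comp_hasDerivAt t hder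
      simpa [Function.comp_def] using hc.trans_eq this.deriv.symm
    rw [hint] at hmono
    simpa using hmono
  -- Failure at x would be an open condition, hence would occur at one of the good base points,
  -- which are dense.
  have hcont : ContinuousAt (fun y => g (y + v) - g y) x := by
    refine ContinuousAt.sub ?_ (hg.continuousOn.continuousAt (hBo.mem_nhds hx))
    exact ContinuousAt.comp (f := fun y => y + v)
      (hg.continuousOn.continuousAt (hBo.mem_nhds hxv)) (by fun_prop)
  by_contra hlt
  have he : ∀ᶠ y in 𝓝 x, g (y + v) - g y < c ∧ y ∈ B ∧ y + v ∈ B := by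
    refine (hcont.eventually_lt_const (not_le.1 hlt)).and (Eventually.and (hBo.mem_nhds hx) ?_)
    exact (continuous_add_const v).continuousAt.preimage_mem_nhds (hBo.mem_nhds hxv)
  obtain ⟨y, hyg, hy⟩ := (Measure.dense_of_ae h3).inter_nhds_nonempty he
  exact absurd (h4 y hyg hy.2.1 hy.2.2) (not_le.2 hy.1)

/-- A convex set at distance at least `c` from the origin is separated from it by a unit vector,
with gap `c`. -/
theorem exists_unit_inner_ge {E : Type*} [NormedAddCommGroup E] [InnerProductSpace ℝ E]
    [CompleteSpace E] {S : Set E} (hS : Convex ℝ S) (hne : S.Nonempty) {c : ℝ} (hc : 0 < c)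
    (h : ∀ a ∈ S, c ≤ ‖a‖) : ∃ w : E, ‖w‖ = 1 ∧ ∀ a ∈ S, c ≤ inner ℝ w a := by
  have hcl : ∀ a ∈ closure S, c ≤ ‖a‖ := fun a ha =>
    (isClosed_le continuous_const continuous_norm).closure_subset_iff.2 h ha
  -- The normal direction is that of the point a₀ of the closure nearest the origin: ⟨a₀, a⟩ ≥ ‖a₀‖²
  -- for every a in S.
  obtain ⟨a₀, ha₀, hmin⟩ := exists_norm_eq_iInf_of_complete_convex hne.closure
    isClosed_closure.isComplete hS.closure 0
  have hin := (norm_eq_iInf_iff_real_inner_le_zero hS.closure ha₀).1 hmin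
  have hpos : 0 < ‖a₀‖ := hc.trans_le (hcl a₀ ha₀)
  refine ⟨‖a₀‖⁻¹ • a₀, by rw [norm_smul, norm_inv, norm_norm, inv_mul_cancel₀ hpos.ne'],
    fun a ha => ?_⟩
  have h1 := hin a (subset_closure ha)
  rw [zero_sub, inner_neg_left, inner_sub_right, real_inner_self_eq_norm_sq] at h1
  rw [inner_smul_left]
  refine (hcl a₀ ha₀).trans ?_
  simp only [map_inv₀, conj_trivial]
  rw [inv_mul_eq_div, le_div_iff₀ hpos]
  nlinarith

/-- The convex hull of a compact set in a finite dimensional space is compact. -/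
theorem isCompact_convexHull_of_isCompact {E : Type*} [NormedAddCommGroup E] [NormedSpace ℝ E]
    [FiniteDimensional ℝ E] {S : Set E} (hS : IsCompact S) : IsCompact (convexHull ℝ S) := by
  rcases S.eq_empty_or_nonempty with rfl | ⟨s₀, hs₀⟩
  · simp
  -- Carathéodory: d points always suffice, so the hull is a continuous image of a simplex times a
  -- power of S. Unused slots get weight 0 and the point s₀.
  let d := Module.finrank ℝ E + 1
  have himg : convexHull ℝ S = (fun q : (Fin d → ℝ) × (Fin d → E) => ∑ i, q.1 i • q.2 i) ''
      (stdSimplex ℝ (Fin d) ×ˢ Set.univ.pi fun _ => S) := by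
    refine Subset.antisymm (fun x hx => ?_) ?_
    · obtain ⟨ι, _, z, w, hz, hai, hw, hw1, hsum⟩ := eq_pos_convex_span_of_mem_convexHull hx
      have hcard : Fintype.card ι ≤ Fintype.card (Fin d) := by
        rw [Fintype.card_fin]
        exact hai.card_le_finrank_succ.trans (Nat.succ_le_succ (Submodule.finrank_le _))
      obtain ⟨e⟩ := Function.Embedding.nonempty_of_card_le hcard
      classical
      refine ⟨(Function.extend e w 0, Function.extend e z fun _ => s₀), ⟨⟨fun i => ?_, ?_⟩, ?_⟩, ?_⟩
      · by_cases hi : ∃ j, e j = i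
        · obtain ⟨j, rfl⟩ := hi
          simpa [e.injective.extend_apply] using (hw j).le
        · simp [Function.extend_apply' _ _ _ hi]
      · rw [← hw1]
        refine (Fintype.sum_of_injective e e.injective _ _ (fun i hi => ?_) fun i => ?_).symm
        · exact Function.extend_apply' _ _ _ hi
        · simp [e.injective.extend_apply]
      · intro i _
        by_cases hi : ∃ j, e j = i
        · obtain ⟨j, rfl⟩ := hi
          simpa [e.injective.extend_apply] using hz (mem_range_self j)
        · simpa [Function.extend_apply' _ _ _ hi] using hs₀
      · rw [← hsum]
        refine (Fintype.sum_of_injective e e.injective _ _ (fun i hi => ?_) fun i => ?_).symm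
        · simp [Function.extend_apply' w (0 : Fin d → ℝ) i hi]
        · simp [e.injective.extend_apply]
    · rintro _ ⟨q, ⟨hq1, hq2⟩, rfl⟩
      exact (convex_convexHull ℝ S).sum_mem (fun i _ => hq1.1 i) hq1.2
        fun i _ => subset_convexHull ℝ S (hq2 i trivial)
  rw [himg]
  refine ((isCompact_stdSimplex ℝ (Fin d)).prod (isCompact_univ_pi fun _ => hS)).image ?_
  fun_prop

open MeasureTheory in
/-- Mean value inequality for Lipschitz maps into an inner product space. -/
theorem le_inner_sub_of_ae_le_inner_fderiv {E F : Type*} [NormedAddCommGroup E] [NormedSpace ℝ E]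
    [FiniteDimensional ℝ E] [MeasurableSpace E] [BorelSpace E] (μ : Measure E)
    [μ.IsAddHaarMeasure] [NormedAddCommGroup F] [InnerProductSpace ℝ F] [FiniteDimensional ℝ F]
    {B : Set E} (hBo : IsOpen B) (hBc : Convex ℝ B) {C : NNReal}
    {φ : E → F} (hφ : LipschitzOnWith C φ B) {v : E} {w : F} {c : ℝ}
    (h : ∀ᵐ x ∂μ, x ∈ B → DifferentiableAt ℝ φ x → c ≤ inner ℝ w (fderiv ℝ φ x v))
    {x : E} (hx : x ∈ B) (hxv : x + v ∈ B) : c ≤ inner ℝ w (φ (x + v) - φ x) := by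
  have hlip : LipschitzOnWith (‖innerSL ℝ w‖₊ * C) (fun y => inner ℝ w (φ y)) B :=
    (innerSL ℝ w).lipschitz.comp_lipschitzOnWith hφ
  rw [inner_sub_right]
  refine le_sub_of_ae_le_fderiv μ hBo hBc hlip ?_ hx hxv
  filter_upwards [h, hφ.ae_differentiableWithinAt_of_mem (μ := μ)] with y hy hd hyB _
  have hd' := (hd hyB).differentiableAt (hBo.mem_nhds hyB)
  have hfd := ((innerSL ℝ w).hasFDerivAt (x := φ y)).comp y hd'.hasFDerivAt
  have hfd' : fderiv ℝ (fun y => inner ℝ w (φ y)) y = (innerSL ℝ w).comp (fderiv ℝ φ y) :=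
    hfd.fderiv
  rw [hfd']
  exact hy hyB hd'

/-- A linear endomorphism that is bounded below is onto. -/
theorem surjective_of_mul_norm_le {E : Type*} [NormedAddCommGroup E] [NormedSpace ℝ E]
    [FiniteDimensional ℝ E] {A : E →L[ℝ] E} {c : ℝ} (hc : 0 < c) (hA : ∀ v, c * ‖v‖ ≤ ‖A v‖) :
    Function.Surjective A := by
  have hinj : Function.Injective A.toLinearMap := by
    refine (injective_iff_map_eq_zero _).2 fun v hv => ?_
    have hv' : A v = 0 := hv
    have h := hA v
    rw [hv', norm_zero] at h
    exact norm_le_zero_iff.1 (nonpos_of_mul_nonpos_right h hc)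
  exact LinearMap.injective_iff_surjective.1 hinj

/-- The adjoint of an endomorphism that is bounded below satisfies the same bound. -/
theorem mul_norm_le_norm_adjoint {E : Type*} [NormedAddCommGroup E]
    [InnerProductSpace ℝ E] [FiniteDimensional ℝ E] {A : E →L[ℝ] E} {c : ℝ} (hc : 0 < c)
    (hA : ∀ v, c * ‖v‖ ≤ ‖A v‖) (u : E) : c * ‖u‖ ≤ ‖ContinuousLinearMap.adjoint A u‖ := by
  obtain ⟨v, hv⟩ := surjective_of_mul_norm_le hc hA u
  rcases eq_or_ne u 0 with rfl | hu
  · simp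
  have hup : 0 < ‖u‖ := norm_pos_iff.2 hu
  have h1 : ‖u‖ ^ 2 ≤ ‖ContinuousLinearMap.adjoint A u‖ * ‖v‖ := by
    rw [← real_inner_self_eq_norm_sq]
    nth_rw 2 [← hv]
    rw [← ContinuousLinearMap.adjoint_inner_left]
    exact real_inner_le_norm _ _
  have h2 := hA v
  rw [hv] at h2
  have h3 : c * ‖u‖ * ‖u‖ ≤ ‖ContinuousLinearMap.adjoint A u‖ * ‖u‖ := by
    nlinarith [norm_nonneg (ContinuousLinearMap.adjoint A u)]
  exact le_of_mul_le_mul_right h3 hup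

/-! ### Inverse function theorem for Lipschitz maps, with explicit radius -/

section Inverse

variable {E : Type*} [NormedAddCommGroup E] [InnerProductSpace ℝ E] [FiniteDimensional ℝ E]
  [MeasurableSpace E] [BorelSpace E] {μ : MeasureTheory.Measure E} [μ.IsAddHaarMeasure]
  {S : Set (E →L[ℝ] E)} {δ : ℝ} {φ : E → E} {x₀ : E} {r : ℝ} {C : NNReal}

/-- Lower Lipschitz bound for a Lipschitz map whose derivatives are close to a convex set of
uniformly invertible linear maps. -/
theorem mul_norm_sub_le_of_fderiv_near (hS : Convex ℝ S) (hne : S.Nonempty) (hδ : 0 < δ)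
    (hSδ : ∀ A ∈ S, ∀ v, 2 * δ * ‖v‖ ≤ ‖A v‖) (hφ : LipschitzOnWith C φ (ball x₀ r))
    (hD : ∀ᵐ x ∂μ, x ∈ ball x₀ r → ∃ A ∈ S, ‖fderiv ℝ φ x - A‖ ≤ δ)
    {x y : E} (hx : x ∈ ball x₀ r) (hy : y ∈ ball x₀ r) : δ * ‖x - y‖ ≤ ‖φ x - φ y‖ := by
  rcases eq_or_ne x y with rfl | hxy
  · simp
  have hv : 0 < ‖x - y‖ := norm_pos_iff.2 (sub_ne_zero.2 hxy)
  obtain ⟨w, hw1, hw⟩ := exists_unit_inner_ge (S := (fun A : E →L[ℝ] E => A (x - y)) '' S)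
    (hS.linear_image (ContinuousLinearMap.apply ℝ E (x - y)).toLinearMap) (hne.image _)
    (c := 2 * δ * ‖x - y‖) (by positivity) (by rintro _ ⟨A, hA, rfl⟩; exact hSδ A hA _)
  have hmv : δ * ‖x - y‖ ≤ inner ℝ w (φ (y + (x - y)) - φ y) := by
    refine le_inner_sub_of_ae_le_inner_fderiv μ isOpen_ball
      (convex_ball x₀ r) hφ (hD.mono fun z hDz hz _ => ?_) hy (by simpa using hx)
    obtain ⟨A, hA, hAd⟩ := hDz hz
    have h1 : 2 * δ * ‖x - y‖ ≤ inner ℝ w (A (x - y)) := hw _ ⟨A, hA, rfl⟩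
    have h2 : |inner ℝ w ((fderiv ℝ φ z - A) (x - y))| ≤ δ * ‖x - y‖ := by
      refine (abs_real_inner_le_norm _ _).trans ?_
      rw [hw1, one_mul]
      exact ((fderiv ℝ φ z - A).le_opNorm _).trans (by gcongr)
    rw [_root_.sub_apply, inner_sub_right] at h2
    linarith [(abs_le.1 h2).1]
  rw [add_sub_cancel] at hmv
  refine hmv.trans ((real_inner_le_norm _ _).trans ?_)
  rw [hw1, one_mul]

/-- A Lipschitz map whose derivatives are close to a convex set of uniformly invertible linear
maps covers a ball of explicit radius. -/
theorem ball_subset_image_of_fderiv_near (hS : Convex ℝ S) (hne : S.Nonempty) (hδ : 0 < δ)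
    (hSδ : ∀ A ∈ S, ∀ v, 2 * δ * ‖v‖ ≤ ‖A v‖) (hφ : LipschitzOnWith C φ (ball x₀ r))
    (hD : ∀ᵐ x ∂μ, x ∈ ball x₀ r → ∃ A ∈ S, ‖fderiv ℝ φ x - A‖ ≤ δ) :
    ball (φ x₀) (r * δ / 2) ⊆ φ '' ball x₀ r := by
  intro y hy
  rw [mem_ball, dist_eq_norm] at hy
  -- With this s a minimizer x of the residual over the closed s-ball is interior: δ‖x − x₀‖ ≤ ‖φ x
  -- − φ x₀‖ ≤ 2‖y − φ x₀‖ < sδ.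
  obtain ⟨s, hs1, hs2⟩ : ∃ s, 2 * ‖y - φ x₀‖ / δ < s ∧ s < r :=
    exists_between (by rw [div_lt_iff₀ hδ]; linarith)
  have hs0 : 0 ≤ s := le_trans (by positivity) hs1.le
  rw [div_lt_iff₀ hδ] at hs1
  have hsub : closedBall x₀ s ⊆ ball x₀ r := closedBall_subset_ball hs2
  have hcont : ContinuousOn (fun x => ‖y - φ x‖) (closedBall x₀ s) :=
    (continuousOn_const.sub (hφ.continuousOn.mono hsub)).norm
  obtain ⟨x, hx, hmin⟩ := (isCompact_closedBall x₀ s).exists_isMinOn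
    ⟨x₀, mem_closedBall_self hs0⟩ hcont
  have hx₀r : x₀ ∈ ball x₀ r := hsub (mem_closedBall_self hs0)
  have hxs : x ∈ ball x₀ s := by
    rw [mem_ball, dist_eq_norm]
    have h1 := mul_norm_sub_le_of_fderiv_near hS hne hδ hSδ hφ hD (hsub hx) hx₀r
    have h2 : ‖y - φ x‖ ≤ ‖y - φ x₀‖ := hmin (mem_closedBall_self hs0)
    have h3 : ‖φ x - φ x₀‖ ≤ ‖y - φ x‖ + ‖y - φ x₀‖ := by
      rw [norm_sub_rev y (φ x)]
      exact norm_sub_le_norm_sub_add_norm_sub _ _ _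
    nlinarith
  refine ⟨x, hsub hx, ?_⟩
  by_contra hne'
  have hu : 0 < ‖y - φ x‖ := norm_pos_iff.2 (sub_ne_zero.2 (Ne.symm hne'))
  set u := y - φ x with hu_def
  -- Since ⟨w, A*u⟩ = ⟨u, Aw⟩, this w is one direction in which every A in S moves φ towards y.
  obtain ⟨w, hw1, hw⟩ := exists_unit_inner_ge
    (S := (fun A : E →L[ℝ] E => ContinuousLinearMap.adjoint A u) '' S)
    (by
      refine hS.is_linear_image ⟨fun A B => ?_, fun a A => ?_⟩
      · simp
      · simp)
    (hne.image _) (c := 2 * δ * ‖u‖) (by positivity)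
    (by rintro _ ⟨A, hA, rfl⟩; exact mul_norm_le_norm_adjoint (by positivity) (hSδ A hA) u)
  have hmv : ∀ t : ℝ, 0 < t → x + t • w ∈ ball x₀ r →
      t * (δ * ‖u‖) ≤ inner ℝ u (φ (x + t • w) - φ x) := by
    intro t ht hxt
    refine le_inner_sub_of_ae_le_inner_fderiv μ isOpen_ball
      (convex_ball x₀ r) hφ (hD.mono fun z hDz hz _ => ?_) (hsub hx) hxt
    obtain ⟨A, hA, hAd⟩ := hDz hz
    have h1 : 2 * δ * ‖u‖ ≤ inner ℝ u (A w) := by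
      have := hw _ ⟨A, hA, rfl⟩
      simp only [ContinuousLinearMap.adjoint_inner_right] at this
      rwa [real_inner_comm] at this
    have h2 : |inner ℝ u ((fderiv ℝ φ z - A) w)| ≤ δ * ‖u‖ := by
      refine (abs_real_inner_le_norm _ _).trans ?_
      rw [mul_comm]
      gcongr
      have := (fderiv ℝ φ z - A).le_opNorm w
      rw [hw1, mul_one] at this
      exact this.trans hAd
    rw [_root_.sub_apply, inner_sub_right] at h2
    rw [map_smul, inner_smul_right]
    gcongr
    linarith [(abs_le.1 h2).1]
  -- A step of length t along w changes the squared residual by at most −2tδ‖u‖ + C²t², which is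
  -- negative for such t and contradicts minimality.
  have hlim : ∀ᶠ t : ℝ in 𝓝[>] 0, x + t • w ∈ ball x₀ s ∧ t * (C : ℝ) ^ 2 < 2 * (δ * ‖u‖) := by
    refine nhdsWithin_le_nhds (Eventually.and ?_ ?_)
    · have : ContinuousAt (fun t : ℝ => x + t • w) 0 := by fun_prop
      exact this.eventually_mem (by simpa using isOpen_ball.mem_nhds hxs)
    · have : ContinuousAt (fun t : ℝ => t * (C : ℝ) ^ 2) 0 := by fun_prop
      exact this.eventually_lt_const (by simp only [zero_mul]; positivity)
  obtain ⟨t, ⟨hts, htC⟩, ht0⟩ := (hlim.and self_mem_nhdsWithin).exists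
  have ht0 : 0 < t := ht0
  have hts' := ball_subset_closedBall hts
  have h1 := hmv t ht0 (hsub hts')
  have h2 : ‖u‖ ≤ ‖y - φ (x + t • w)‖ := hmin hts'
  have h3 : ‖φ (x + t • w) - φ x‖ ≤ C * t := by
    refine (hφ.norm_sub_le (hsub hts') (hsub hx)).trans (le_of_eq ?_)
    rw [add_sub_cancel_left, norm_smul, hw1, mul_one, Real.norm_eq_abs, abs_of_pos ht0]
  have h4 : ‖y - φ (x + t • w)‖ ^ 2 = ‖u‖ ^ 2 - 2 * inner ℝ u (φ (x + t • w) - φ x)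
      + ‖φ (x + t • w) - φ x‖ ^ 2 := by
    rw [← norm_sub_sq_real, hu_def]
    congr 2
    abel
  have h5 : ‖u‖ ^ 2 ≤ ‖y - φ (x + t • w)‖ ^ 2 := by gcongr
  have h6 : ‖φ (x + t • w) - φ x‖ ^ 2 ≤ (C * t) ^ 2 := by gcongr
  nlinarith [mul_pos ht0 (sub_pos.2 htC)]

end Inverse

/-! ### Matrices as operators; compactness of the generalized Jacobian -/

/-- The continuous linear map of a matrix, between Euclidean spaces. -/
noncomputable def matrixCLM {m n : ℕ} : Matrix (Fin m) (Fin n) ℝ ≃ₗ[ℝ]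
    (EuclideanSpace ℝ (Fin n) →L[ℝ] EuclideanSpace ℝ (Fin m)) :=
  (Matrix.toEuclideanLin (𝕜 := ℝ) (m := Fin m) (n := Fin n)).trans LinearMap.toContinuousLinearMap

theorem norm_matrixCLM {m n : ℕ} (M : Matrix (Fin m) (Fin n) ℝ) : ‖matrixCLM M‖ = ‖M‖ := rfl

theorem ofLp_matrixCLM {m n : ℕ} (M : Matrix (Fin m) (Fin n) ℝ) (v : EuclideanSpace ℝ (Fin n)) :
    (matrixCLM M v).ofLp = M.mulVec v.ofLp := rfl

theorem matrixCLM_jacobian {m n : ℕ} (f : EuclideanSpace ℝ (Fin n) → EuclideanSpace ℝ (Fin m))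
    (x : EuclideanSpace ℝ (Fin n)) : matrixCLM (jacobian f x) = fderiv ℝ f x := by
  ext v i
  rw [ofLp_matrixCLM]
  have hv : v = ∑ j, v j • EuclideanSpace.single j (1 : ℝ) := by
    ext k
    simp [Finset.sum_apply, Pi.single_apply]
  conv_rhs => rw [hv]
  simp [map_sum, jacobian, Matrix.mulVec, dotProduct, mul_comm]

section Limits

variable {n m : ℕ} {f : EuclideanSpace ℝ (Fin n) → EuclideanSpace ℝ (Fin m)}
  {x₀ : EuclideanSpace ℝ (Fin n)} {U : Set (EuclideanSpace ℝ (Fin n))} {K : ℝ}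

theorem LipBound.lipschitzOnWith {S : Set (EuclideanSpace ℝ (Fin n))} (hK : 0 ≤ K)
    (hf : LipBound f S K) : LipschitzOnWith ⟨K, hK⟩ f S :=
  LipschitzOnWith.of_dist_le_mul fun x hx y hy => by
    rw [dist_eq_norm, dist_eq_norm]
    exact hf x hx y hy

theorem LipBound.norm_jacobian_le (hK : 0 ≤ K) (hf : LipBound f U K)
    {x : EuclideanSpace ℝ (Fin n)} (hx : U ∈ 𝓝 x) : ‖jacobian f x‖ ≤ K := by
  rw [← norm_matrixCLM, matrixCLM_jacobian]
  exact norm_fderiv_le_of_lipschitzOn ℝ hx (hf.lipschitzOnWith hK)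

/-- The constant sequence is allowed; hence hypotheses on the generalized Jacobian apply to the
actual Jacobians. -/
theorem jacobian_mem_genJacobian {x : EuclideanSpace ℝ (Fin n)} (hx : DifferentiableAt ℝ f x) :
    jacobian f x ∈ genJacobian f x :=
  subset_convexHull ℝ _ ⟨fun _ => x, tendsto_const_nhds, fun _ => hx, tendsto_const_nhds⟩

/-- Cluster points of a filter form a closed set, and exist when the filter lives on a compact set;
this gives compactness and nonemptiness of the generalized Jacobian. Sequences suffice because the
filters involved are countably generated. -/
theorem setOf_limit_jacobian_eq :
    {M | ∃ x : ℕ → EuclideanSpace ℝ (Fin n), Tendsto x atTop (𝓝 x₀) ∧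
      (∀ i, DifferentiableAt ℝ f (x i)) ∧ Tendsto (fun i => jacobian f (x i)) atTop (𝓝 M)} =
    {M | ClusterPt M (map (jacobian f) (𝓝 x₀ ⊓ 𝓟 {x | DifferentiableAt ℝ f x}))} := by
  ext M
  constructor
  · rintro ⟨x, hx, hd, hM⟩
    have h1 : Tendsto x atTop (𝓝 x₀ ⊓ 𝓟 {x | DifferentiableAt ℝ f x}) :=
      tendsto_inf.2 ⟨hx, tendsto_principal.2 (Eventually.of_forall hd)⟩
    exact hM.mapClusterPt.of_comp h1
  · intro hM
    have hM' : (comap (jacobian f) (𝓝 M) ⊓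
        (𝓝 x₀ ⊓ 𝓟 {x | DifferentiableAt ℝ f x})).NeBot := by
      have : (𝓝 M ⊓ map (jacobian f) (𝓝 x₀ ⊓ 𝓟 {x | DifferentiableAt ℝ f x})).NeBot := hM
      rw [inf_comm, ← Filter.push_pull, inf_comm] at this
      exact this.of_map
    obtain ⟨x, hx⟩ := exists_seq_tendsto (comap (jacobian f) (𝓝 M) ⊓
        (𝓝 x₀ ⊓ 𝓟 {x | DifferentiableAt ℝ f x}))
    rw [tendsto_inf, tendsto_inf, tendsto_principal, tendsto_comap_iff] at hx
    obtain ⟨hx1, hx2, hx3⟩ := hx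
    obtain ⟨N, hN⟩ := eventually_atTop.1 hx3
    exact ⟨fun i => x (i + N), hx2.comp (tendsto_add_atTop_nat N),
      fun i => hN _ (Nat.le_add_left _ _), hx1.comp (tendsto_add_atTop_nat N)⟩

theorem LipBound.eventually_jacobian_mem (hK : 0 ≤ K) (hU : U ∈ 𝓝 x₀) (hf : LipBound f U K) :
    ∀ᶠ x in 𝓝 x₀ ⊓ 𝓟 {x | DifferentiableAt ℝ f x}, jacobian f x ∈ closedBall 0 K := by
  refine Filter.Eventually.filter_mono inf_le_left ?_
  filter_upwards [eventually_mem_nhds_iff.2 hU] with x hx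
  rw [mem_closedBall_zero_iff]
  exact hf.norm_jacobian_le hK hx

theorem LipBound.genJacobian_subset (hK : 0 ≤ K) (hU : U ∈ 𝓝 x₀) (hf : LipBound f U K) :
    genJacobian f x₀ ⊆ closedBall 0 K := by
  refine convexHull_min ?_ (convex_closedBall _ _)
  rw [setOf_limit_jacobian_eq]
  intro M hM
  exact isClosed_closedBall.closure_subset (clusterPt_iff_forall_mem_closure.1 hM _
    (mem_map.2 (hf.eventually_jacobian_mem hK hU)))

theorem LipBound.isCompact_genJacobian (hK : 0 ≤ K) (hU : U ∈ 𝓝 x₀) (hf : LipBound f U K) :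
    IsCompact (genJacobian f x₀) := by
  have hsub := (subset_convexHull ℝ _).trans (hf.genJacobian_subset hK hU)
  refine isCompact_convexHull_of_isCompact ?_
  refine (isCompact_closedBall (0 : Matrix (Fin m) (Fin n) ℝ) K).of_isClosed_subset ?_ hsub
  rw [setOf_limit_jacobian_eq]
  exact isClosed_setOfPred_clusterPt

theorem LipBound.genJacobian_nonempty (hK : 0 ≤ K) (hU : U ∈ 𝓝 x₀) (hf : LipBound f U K) :
    (genJacobian f x₀).Nonempty := by
  -- Rademacher: points of differentiability accumulate at x₀.
  have hne : (𝓝 x₀ ⊓ 𝓟 {x | DifferentiableAt ℝ f x}).NeBot := by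
    have h1 : ∀ᵐ x ∂(MeasureTheory.volume : MeasureTheory.Measure (EuclideanSpace ℝ (Fin n))),
        x ∈ interior U → DifferentiableAt ℝ f x := by
      filter_upwards [((hf.lipschitzOnWith hK).mono
        interior_subset).ae_differentiableWithinAt_of_mem] with x hx hxU
      exact (hx hxU).differentiableAt (isOpen_interior.mem_nhds hxU)
    refine mem_closure_iff_clusterPt.1 (mem_closure_iff_nhds.2 fun V hV => ?_)
    obtain ⟨y, hy1, hy2⟩ := (MeasureTheory.Measure.dense_of_ae h1).inter_nhds_nonempty
      (inter_mem hV (interior_mem_nhds.2 hU))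
    exact ⟨y, hy2.1, hy1 hy2.2⟩
  obtain ⟨M, -, hM⟩ := (isCompact_closedBall (0 : Matrix (Fin m) (Fin n) ℝ) K)
    (f := map (jacobian f) (𝓝 x₀ ⊓ 𝓟 {x | DifferentiableAt ℝ f x}))
    (by rw [le_principal_iff]; exact hf.eventually_jacobian_mem hK hU)
  refine ⟨M, subset_convexHull ℝ _ ?_⟩
  rw [setOf_limit_jacobian_eq]
  exact hM

end Limits

/-! ### The constant δ -/

/-- A square matrix of full rank has unit determinant. -/
theorem isUnit_det_of_rank_eq {p : ℕ} {M : Matrix (Fin p) (Fin p) ℝ} (h : M.rank = p) :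
    IsUnit M.det := by
  rw [← Matrix.isUnit_iff_isUnit_det, ← Matrix.mulVec_surjective_iff_isUnit]
  have : LinearMap.range M.mulVecLin = ⊤ := by
    apply Submodule.eq_top_of_finrank_eq
    rw [Module.finrank_fin_fun]
    exact h
  exact LinearMap.range_eq_top.1 this

/-- Inversion is continuous on a compact set of invertible matrices, so the infimum is attained, at
a positive value. -/
theorem blockDelta_pos {p : ℕ} {S : Set (Matrix (Fin p) (Fin p) ℝ)} (hS : IsCompact S)
    (hne : S.Nonempty) (hrank : OfRank S p) (K : ℝ) : 0 < blockDelta S K := by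
  have hcont : ContinuousOn
      (fun M₁ : Matrix (Fin p) (Fin p) ℝ => 1 / Real.sqrt (1 + (1 + K) ^ 2 * ‖M₁⁻¹‖ ^ 2)) S := by
    have hinv : ContinuousOn (fun M₁ : Matrix (Fin p) (Fin p) ℝ => M₁⁻¹) S := by
      simp only [Matrix.inv_def, Ring.inverse_eq_inv']
      refine ContinuousOn.smul (ContinuousOn.inv₀ (Continuous.matrix_det continuous_id).continuousOn
        fun M hM => ?_) (Continuous.matrix_adjugate continuous_id).continuousOn
      exact (isUnit_det_of_rank_eq (hrank M hM)).ne_zero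
    refine continuousOn_const.div (Real.continuous_sqrt.comp_continuousOn
      (continuousOn_const.add (continuousOn_const.mul (hinv.norm.pow 2)))) fun M _ => ?_
    positivity
  obtain ⟨M, -, hM⟩ := (hS.image_of_continuousOn hcont).sInf_mem (hne.image _)
  unfold blockDelta
  rw [← hM]
  positivity

theorem blockDelta_le {p : ℕ} {S : Set (Matrix (Fin p) (Fin p) ℝ)} (K : ℝ)
    {M : Matrix (Fin p) (Fin p) ℝ} (hM : M ∈ S) :
    2 * blockDelta S K ≤ 1 / Real.sqrt (1 + (1 + K) ^ 2 * ‖M⁻¹‖ ^ 2) := by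
  have : sInf ((fun M₁ : Matrix (Fin p) (Fin p) ℝ =>
      1 / Real.sqrt (1 + (1 + K) ^ 2 * ‖M₁⁻¹‖ ^ 2)) '' S) ≤
      1 / Real.sqrt (1 + (1 + K) ^ 2 * ‖M⁻¹‖ ^ 2) :=
    csInf_le ⟨0, by rintro _ ⟨N, -, rfl⟩; positivity⟩ ⟨M, hM, rfl⟩
  unfold blockDelta
  linarith

/-! ### Splitting off the first p coordinates; completion and shear -/

section Coordinates

variable {n m p : ℕ}

/-- Restriction to the first `p` coordinates. -/
noncomputable def res (h : p ≤ n) : EuclideanSpace ℝ (Fin n) →L[ℝ] EuclideanSpace ℝ (Fin p) :=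
  LinearMap.toContinuousLinearMap
    { toFun := fun v => WithLp.toLp 2 fun i => v (Fin.castLE h i)
      map_add' := fun _ _ => rfl
      map_smul' := fun _ _ => rfl }

/-- Extension by zero in the coordinates after the first `p`. -/
noncomputable def pad (_h : p ≤ n) : EuclideanSpace ℝ (Fin p) →L[ℝ] EuclideanSpace ℝ (Fin n) :=
  LinearMap.toContinuousLinearMap
    { toFun := fun w => WithLp.toLp 2 fun j => if hj : (j : ℕ) < p then w ⟨j, hj⟩ else 0
      map_add' := fun v w => by
        ext j
        by_cases hj : (j : ℕ) < p <;> simp [hj]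
      map_smul' := fun a w => by
        ext j
        by_cases hj : (j : ℕ) < p <;> simp [hj] }

/-- Projection killing the first `p` coordinates. -/
noncomputable def tail (h : p ≤ n) : EuclideanSpace ℝ (Fin n) →L[ℝ] EuclideanSpace ℝ (Fin n) :=
  ContinuousLinearMap.id ℝ _ - (pad h).comp (res h)

theorem res_apply (h : p ≤ n) (v : EuclideanSpace ℝ (Fin n)) (i : Fin p) :
    res h v i = v (Fin.castLE h i) := rfl

theorem pad_apply (h : p ≤ n) (w : EuclideanSpace ℝ (Fin p)) (j : Fin n) :
    pad h w j = if hj : (j : ℕ) < p then w ⟨j, hj⟩ else 0 := rfl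

theorem tail_apply (h : p ≤ n) (v : EuclideanSpace ℝ (Fin n)) :
    tail h v = v - pad h (res h v) := rfl

theorem pad_res_add_tail (h : p ≤ n) (v : EuclideanSpace ℝ (Fin n)) :
    pad h (res h v) + tail h v = v := by
  rw [tail_apply, add_sub_cancel]

@[simp]
theorem res_pad (h : p ≤ n) (w : EuclideanSpace ℝ (Fin p)) : res h (pad h w) = w := by
  ext i
  simp [res_apply, pad_apply]

@[simp]
theorem res_tail (h : p ≤ n) (v : EuclideanSpace ℝ (Fin n)) : res h (tail h v) = 0 := by
  rw [tail_apply, map_sub, res_pad, sub_self]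

@[simp]
theorem tail_pad (h : p ≤ n) (w : EuclideanSpace ℝ (Fin p)) : tail h (pad h w) = 0 := by
  rw [tail_apply, res_pad, sub_self]

@[simp]
theorem tail_tail (h : p ≤ n) (v : EuclideanSpace ℝ (Fin n)) : tail h (tail h v) = tail h v := by
  rw [tail_apply, res_tail, map_zero, sub_zero]

theorem inner_pad (h : p ≤ n) (v : EuclideanSpace ℝ (Fin n)) (w : EuclideanSpace ℝ (Fin p)) :
    inner ℝ v (pad h w) = inner ℝ (res h v) w := by
  rw [PiLp.inner_apply, PiLp.inner_apply]
  refine (Fintype.sum_of_injective (Fin.castLE h) (Fin.castLE_injective h) _ _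
    (fun j hj => ?_) fun i => ?_).symm
  · rw [pad_apply, dif_neg, inner_zero_right]
    exact fun hjp => hj ⟨⟨j, hjp⟩, rfl⟩
  · simp [res_apply, pad_apply]

@[simp]
theorem norm_pad (h : p ≤ n) (w : EuclideanSpace ℝ (Fin p)) : ‖pad h w‖ = ‖w‖ := by
  rw [← sq_eq_sq₀ (norm_nonneg _) (norm_nonneg _), ← real_inner_self_eq_norm_sq, inner_pad,
    res_pad, real_inner_self_eq_norm_sq]

theorem norm_sq_eq_add (h : p ≤ n) (v : EuclideanSpace ℝ (Fin n)) :
    ‖v‖ ^ 2 = ‖res h v‖ ^ 2 + ‖tail h v‖ ^ 2 := by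
  rw [tail_apply, norm_sub_sq_real, inner_pad, real_inner_self_eq_norm_sq, norm_pad]
  ring

theorem norm_res_le (h : p ≤ n) (v : EuclideanSpace ℝ (Fin n)) : ‖res h v‖ ≤ ‖v‖ := by
  rw [← sq_le_sq₀ (norm_nonneg _) (norm_nonneg _), norm_sq_eq_add h v]
  nlinarith [sq_nonneg ‖tail h v‖]

theorem norm_tail_le (h : p ≤ n) (v : EuclideanSpace ℝ (Fin n)) : ‖tail h v‖ ≤ ‖v‖ := by
  rw [← sq_le_sq₀ (norm_nonneg _) (norm_nonneg _), norm_sq_eq_add h v]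
  nlinarith [sq_nonneg ‖res h v‖]

/-- Replace the components after the first `p` by the coordinates of the source. -/
noncomputable def complete (hpn : p ≤ n) (hpm : p ≤ m)
    (A : EuclideanSpace ℝ (Fin n) →L[ℝ] EuclideanSpace ℝ (Fin m)) :
    EuclideanSpace ℝ (Fin n) →L[ℝ] EuclideanSpace ℝ (Fin n) :=
  (pad hpn).comp ((res hpm).comp A) + tail hpn

theorem complete_apply (hpn : p ≤ n) (hpm : p ≤ m)
    (A : EuclideanSpace ℝ (Fin n) →L[ℝ] EuclideanSpace ℝ (Fin m)) (v : EuclideanSpace ℝ (Fin n)) :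
    complete hpn hpm A v = pad hpn (res hpm (A v)) + tail hpn v := rfl

theorem norm_complete_sub_le (hpn : p ≤ n) (hpm : p ≤ m)
    (A B : EuclideanSpace ℝ (Fin n) →L[ℝ] EuclideanSpace ℝ (Fin m)) :
    ‖complete hpn hpm A - complete hpn hpm B‖ ≤ ‖A - B‖ := by
  refine ContinuousLinearMap.opNorm_le_bound _ (norm_nonneg _) fun v => ?_
  rw [_root_.sub_apply, complete_apply, complete_apply, add_sub_add_right_eq_sub,
    ← map_sub, ← map_sub, norm_pad]
  exact (norm_res_le hpm _).trans ((A - B).le_opNorm v)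

/-- `complete` is only affine in A: the summand `tail` survives because the weights add to 1. -/
theorem convex_image_complete (hpn : p ≤ n) (hpm : p ≤ m) {S : Set (Matrix (Fin m) (Fin n) ℝ)}
    (hS : Convex ℝ S) : Convex ℝ ((fun M => complete hpn hpm (matrixCLM M)) '' S) := by
  rintro _ ⟨M, hM, rfl⟩ _ ⟨N, hN, rfl⟩ a b ha hb hab
  refine ⟨a • M + b • N, hS hM hN ha hb hab, ContinuousLinearMap.ext fun v => ?_⟩
  have : tail hpn v = a • tail hpn v + b • tail hpn v := by rw [← add_smul, hab, one_smul]
  simp only [map_add, map_smul, complete_apply, _root_.add_apply, _root_.smul_apply, smul_add]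
  conv_lhs => rw [this]
  abel

theorem matrixCLM_submatrix (hpn : p ≤ n) (hpm : p ≤ m) (M : Matrix (Fin m) (Fin n) ℝ)
    (w : EuclideanSpace ℝ (Fin p)) :
    matrixCLM (M.submatrix (Fin.castLE hpm) (Fin.castLE hpn)) w =
      res hpm (matrixCLM M (pad hpn w)) := by
  ext i
  rw [res_apply, ofLp_matrixCLM, ofLp_matrixCLM, Matrix.mulVec, Matrix.mulVec, dotProduct,
    dotProduct]
  refine Fintype.sum_of_injective (Fin.castLE hpn) (Fin.castLE_injective hpn) _ _
    (fun j hj => ?_) fun i => ?_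
  · rw [pad_apply, dif_neg, mul_zero]
    exact fun hjp => hj ⟨⟨j, hjp⟩, rfl⟩
  · simp [pad_apply]

/-- Solve [[M₁, M₂], [0, I]] v = w: the tail of v is that of w, and M₁v₁ = w₁ − M₂w₂ has norm at
most (1 + K)‖w‖. Adding squares produces the constant in δ. -/
theorem norm_le_mul_norm_complete (hpn : p ≤ n) (hpm : p ≤ m) {M : Matrix (Fin m) (Fin n) ℝ}
    {K : ℝ} (hM : ‖M‖ ≤ K) {M₁ : Matrix (Fin p) (Fin p) ℝ}
    (hM₁ : M₁ = M.submatrix (Fin.castLE hpm) (Fin.castLE hpn)) (hdet : IsUnit M₁.det)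
    (v : EuclideanSpace ℝ (Fin n)) :
    ‖v‖ ≤ Real.sqrt (1 + (1 + K) ^ 2 * ‖M₁⁻¹‖ ^ 2) * ‖complete hpn hpm (matrixCLM M) v‖ := by
  have hK : 0 ≤ K := (norm_nonneg M).trans hM
  set A := matrixCLM M
  set w := complete hpn hpm A v with hw
  have hres : res hpn w = res hpm (A v) := by simp [hw, complete_apply]
  have htail : tail hpn w = tail hpn v := by simp [hw, complete_apply]
  have h1 : matrixCLM M₁ (res hpn v) = res hpn w - res hpm (A (tail hpn w)) := by
    rw [hM₁, matrixCLM_submatrix, hres, htail, ← map_sub, ← map_sub]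
    congr 2
    rw [tail_apply, sub_sub_cancel]
  have h2 : res hpn v = matrixCLM M₁⁻¹ (matrixCLM M₁ (res hpn v)) := by
    ext i
    rw [ofLp_matrixCLM, ofLp_matrixCLM, Matrix.mulVec_mulVec, Matrix.nonsing_inv_mul _ hdet,
      Matrix.one_mulVec]
  have h3 : ‖res hpn w - res hpm (A (tail hpn w))‖ ≤ (1 + K) * ‖w‖ := by
    refine (norm_sub_le _ _).trans ?_
    have h4 : ‖A (tail hpn w)‖ ≤ K * ‖w‖ :=
      (A.le_opNorm _).trans (mul_le_mul hM (norm_tail_le _ _) (norm_nonneg _) hK)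
    linarith [norm_res_le hpn w, norm_res_le hpm (A (tail hpn w))]
  have h5 : ‖res hpn v‖ ≤ ‖M₁⁻¹‖ * ((1 + K) * ‖w‖) := by
    rw [h2, h1]
    exact ((matrixCLM M₁⁻¹).le_opNorm _).trans
      (mul_le_mul_of_nonneg_left h3 (norm_nonneg _))
  rw [← sq_le_sq₀ (norm_nonneg _) (by positivity), mul_pow, Real.sq_sqrt (by positivity),
    norm_sq_eq_add hpn v, ← htail]
  have h6 : ‖res hpn v‖ ^ 2 ≤ (‖M₁⁻¹‖ * ((1 + K) * ‖w‖)) ^ 2 := by gcongr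
  have h7 : ‖tail hpn w‖ ^ 2 ≤ ‖w‖ ^ 2 := by gcongr; exact norm_tail_le _ _
  linarith

theorem finrank_range_matrixCLM (M : Matrix (Fin m) (Fin n) ℝ) :
    Module.finrank ℝ (LinearMap.range (matrixCLM M).toLinearMap) = M.rank := by
  have h : (matrixCLM M).toLinearMap = Matrix.toEuclideanLin M := rfl
  rw [h, Matrix.toEuclideanLin_eq_toLin_orthonormal, ← Matrix.rank_eq_finrank_range_toLin]

/-- A linear map of rank `p` whose completion is onto vanishes where its completion has vanishing
first `p` coordinates. -/
theorem apply_eq_zero_of_res_complete (hpn : p ≤ n) (hpm : p ≤ m)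
    {A : EuclideanSpace ℝ (Fin n) →L[ℝ] EuclideanSpace ℝ (Fin m)}
    (hA : Module.finrank ℝ (LinearMap.range A.toLinearMap) = p)
    (hsurj : Function.Surjective (complete hpn hpm A)) {v : EuclideanSpace ℝ (Fin n)}
    (hv : res hpn (complete hpn hpm A v) = 0) : A v = 0 := by
  -- On the range of A, of dimension p, taking the first p coordinates is onto ℝᵖ, hence injective.
  let R := (res hpm).toLinearMap.domRestrict (LinearMap.range A.toLinearMap)
  have hR : Function.Surjective R := by
    intro y
    obtain ⟨u, hu⟩ := hsurj (pad hpn y)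
    refine ⟨⟨A u, LinearMap.mem_range_self _ u⟩, ?_⟩
    have hu' : res hpm (A u) = y := by simpa [complete_apply] using congrArg (res hpn) hu
    exact hu'
  have hinj := (LinearMap.injective_iff_surjective_of_finrank_eq_finrank
    (f := R) (by rw [hA, finrank_euclideanSpace_fin])).2 hR
  have h0 : R ⟨A v, LinearMap.mem_range_self _ v⟩ = R 0 := by
    have hv' : res hpm (A v) = 0 := by simpa [complete_apply] using hv
    rw [map_zero]
    exact hv'
  exact congrArg Subtype.val (hinj h0)

/-- A map into `ℝᵐ` that preserves the first `p` coordinates and depends only on them is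
straightened by a shear of the target. -/
theorem exists_shear (hpn : p ≤ n) (hpm : p ≤ m)
    {F : EuclideanSpace ℝ (Fin n) → EuclideanSpace ℝ (Fin m)} {z₀ : EuclideanSpace ℝ (Fin n)}
    {ρ C : ℝ} (hC : 0 ≤ C) (hF : LipBound F (ball z₀ ρ) C)
    (hres : ∀ z ∈ ball z₀ ρ, res hpm (F z) = res hpn z)
    (hdep : ∀ z ∈ ball z₀ ρ, ∀ z' ∈ ball z₀ ρ, res hpn z = res hpn z' → F z = F z') :
    ∃ ψ : OpenPartialHomeomorph (EuclideanSpace ℝ (Fin m)) (EuclideanSpace ℝ (Fin m)),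
      ψ.source = res hpm ⁻¹' ball (res hpn z₀) ρ ∧ LipBound ψ ψ.source (1 + C) ∧
      LipBound ψ.symm ψ.target (1 + C) ∧ ∀ z ∈ ball z₀ ρ, ψ (F z) = pad hpm (res hpn z) := by
  let ι : EuclideanSpace ℝ (Fin p) → EuclideanSpace ℝ (Fin n) := fun y => pad hpn y + tail hpn z₀
  have hι : ∀ y ∈ ball (res hpn z₀) ρ, ι y ∈ ball z₀ ρ := by
    intro y hy
    rw [mem_ball, dist_eq_norm] at hy ⊢
    have : ι y - z₀ = pad hpn (y - res hpn z₀) := by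
      rw [map_sub, ← pad_res_add_tail hpn z₀]
      simp [ι]
    rwa [this, norm_pad]
  -- The image of F is the graph of H, read off on the slice through z₀. Subtracting H leaves the
  -- first p coordinates alone, so adding it back is the inverse and the cylinder W is preserved.
  let H : EuclideanSpace ℝ (Fin p) → EuclideanSpace ℝ (Fin m) := fun y => tail hpm (F (ι y))
  have hresH : ∀ y, res hpm (H y) = 0 := fun y => res_tail _ _
  set W := res hpm ⁻¹' ball (res hpn z₀) ρ with hW
  have hH : ∀ x ∈ W, ∀ y ∈ W, ‖H (res hpm x) - H (res hpm y)‖ ≤ C * ‖x - y‖ := by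
    intro x hx y hy
    simp only [H]
    rw [← map_sub]
    refine (norm_tail_le _ _).trans ((hF _ (hι _ hx) _ (hι _ hy)).trans ?_)
    gcongr
    simp only [ι]
    rw [add_sub_add_right_eq_sub, ← map_sub, norm_pad, ← map_sub]
    exact norm_res_le _ _
  have hlip1 : LipBound (fun y => y - H (res hpm y)) W (1 + C) := by
    intro x hx y hy
    rw [sub_sub_sub_comm]
    refine (norm_sub_le _ _).trans ?_
    linarith [hH x hx y hy]
  have hlip2 : LipBound (fun y => y + H (res hpm y)) W (1 + C) := by
    intro x hx y hy
    rw [add_sub_add_comm]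
    refine (norm_add_le _ _).trans ?_
    linarith [hH x hx y hy]
  have hWo : IsOpen W := isOpen_ball.preimage (res hpm).continuous
  refine ⟨{ toFun := fun y => y - H (res hpm y)
            invFun := fun y => y + H (res hpm y)
            source := W
            target := W
            map_source' := fun y hy => by simpa [hW, hresH] using hy
            map_target' := fun y hy => by simpa [hW, hresH] using hy
            left_inv' := fun y _ => by simp [hresH]
            right_inv' := fun y _ => by simp [hresH]
            open_source := hWo
            open_target := hWo
            continuousOn_toFun := (hlip1.lipschitzOnWith (by positivity)).continuousOn
            continuousOn_invFun := (hlip2.lipschitzOnWith (by positivity)).continuousOn },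
    rfl, hlip1, hlip2, fun z hz => ?_⟩
  have hz' : res hpn z ∈ ball (res hpn z₀) ρ := by
    rw [mem_ball, dist_eq_norm] at hz ⊢
    rw [← map_sub]
    exact (norm_res_le _ _).trans_lt hz
  have hFz : F (ι (res hpn z)) = F z := hdep _ (hι _ hz') _ hz (by simp [ι])
  change F z - H (res hpm (F z)) = _
  simp only [H]
  rw [hres z hz, hFz, tail_apply, sub_sub_cancel, hres z hz]

end Coordinates

/-! ### Straightening coordinates and dependence on p variables -/

open MeasureTheory in
/-- Lipschitz endomorphisms carry almost everywhere properties to almost everywhere properties. -/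
theorem ae_forall_of_lipschitzOn {E : Type*} [NormedAddCommGroup E] [NormedSpace ℝ E]
    [FiniteDimensional ℝ E] [MeasurableSpace E] [BorelSpace E] {B : Set E} {C : NNReal}
    {φ : E → E} (hφ : LipschitzOnWith C φ B) {P : E → Prop}
    (h : ∀ᵐ x ∂(μH[Module.finrank ℝ E] : Measure E), x ∈ B → P x) :
    ∀ᵐ z ∂(μH[Module.finrank ℝ E] : Measure E), ∀ x ∈ B, φ x = z → P x := by
  -- Lipschitz maps multiply Hausdorff measure by at most a constant, so they preserve null sets.
  have h0 : (μH[Module.finrank ℝ E] : Measure E) (φ '' {x | ¬ (x ∈ B → P x)}) = 0 := by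
    refine le_antisymm ((LipschitzOnWith.hausdorffMeasure_image_le (hφ.mono fun x hx => ?_)
      (Nat.cast_nonneg _)).trans_eq ?_) zero_le
    · exact (Classical.not_imp.1 hx).1
    · rw [ae_iff.1 h, mul_zero]
  filter_upwards [measure_eq_zero_iff_ae_notMem.1 h0] with z hz x hx hxz
  by_contra hP
  exact hz ⟨x, fun h => hP (h hx), hxz⟩

section Straighten

variable {n m p : ℕ}

/-- The map with first components those of `f` and remaining components those of its argument. -/
noncomputable def straighten (hpn : p ≤ n) (hpm : p ≤ m)
    (f : EuclideanSpace ℝ (Fin n) → EuclideanSpace ℝ (Fin m)) (x : EuclideanSpace ℝ (Fin n)) :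
    EuclideanSpace ℝ (Fin n) :=
  pad hpn (res hpm (f x)) + tail hpn x

variable {hpn : p ≤ n} {hpm : p ≤ m}
  {f : EuclideanSpace ℝ (Fin n) → EuclideanSpace ℝ (Fin m)}

theorem res_straighten (x : EuclideanSpace ℝ (Fin n)) :
    res hpn (straighten hpn hpm f x) = res hpm (f x) := by
  simp [straighten]

theorem LipBound.straighten {S : Set (EuclideanSpace ℝ (Fin n))} {K : ℝ} (hf : LipBound f S K) :
    LipBound (straighten hpn hpm f) S (K + 1) := by
  intro x hx y hy
  simp only [LipschitzRank.straighten]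
  rw [add_sub_add_comm, ← map_sub, ← map_sub, ← map_sub]
  refine (norm_add_le _ _).trans ?_
  rw [norm_pad]
  linarith [norm_res_le hpm (f x - f y), hf x hx y hy, norm_tail_le hpn (x - y)]

theorem hasFDerivAt_straighten {x : EuclideanSpace ℝ (Fin n)} (hx : DifferentiableAt ℝ f x) :
    HasFDerivAt (straighten hpn hpm f) (complete hpn hpm (fderiv ℝ f x)) x :=
  ((pad hpn).hasFDerivAt.comp x ((res hpm).hasFDerivAt.comp x hx.hasFDerivAt)).add
    (tail hpn).hasFDerivAt

end Straighten

section Factor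

variable {n m p : ℕ} {hpn : p ≤ n} {hpm : p ≤ m}
  {f : EuclideanSpace ℝ (Fin n) → EuclideanSpace ℝ (Fin m)}

/-- If `f` has derivatives of rank `p` whose completions are onto, then in the coordinates
given by `straighten` it depends only on the first `p` variables. -/
theorem eq_of_res_eq {B T : Set (EuclideanSpace ℝ (Fin n))} {C L : NNReal}
    {g : EuclideanSpace ℝ (Fin n) → EuclideanSpace ℝ (Fin n)} (hB : IsOpen B) (hT : IsOpen T)
    (hTc : Convex ℝ T) (hφ : LipschitzOnWith C (straighten hpn hpm f) B)
    (hgB : MapsTo g T B) (hφg : ∀ z ∈ T, straighten hpn hpm f (g z) = z)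
    (hgφ : ∀ x ∈ B, straighten hpn hpm f x ∈ T → g (straighten hpn hpm f x) = x)
    (hF : LipschitzOnWith L (fun z => f (g z)) T)
    (hD : ∀ᵐ x ∂(MeasureTheory.Measure.hausdorffMeasure
      (Module.finrank ℝ (EuclideanSpace ℝ (Fin n))) :
      MeasureTheory.Measure (EuclideanSpace ℝ (Fin n))), x ∈ B → DifferentiableAt ℝ f x ∧
      Module.finrank ℝ (LinearMap.range (fderiv ℝ f x).toLinearMap) = p ∧
      Function.Surjective (complete hpn hpm (fderiv ℝ f x)))
    {z z' : EuclideanSpace ℝ (Fin n)} (hz : z ∈ T) (hz' : z' ∈ T) (h : res hpn z = res hpn z') :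
    f (g z) = f (g z') := by
  -- Testing against every w suffices: the negative of the difference itself then yields −‖f (g z')
  -- − f (g z)‖² ≥ 0.
  have key : ∀ w : EuclideanSpace ℝ (Fin m), 0 ≤ inner ℝ w (f (g (z + (z' - z))) - f (g z)) := by
    intro w
    refine le_inner_sub_of_ae_le_inner_fderiv (φ := fun z => f (g z))
      (MeasureTheory.Measure.hausdorffMeasure (Module.finrank ℝ (EuclideanSpace ℝ (Fin n)))) hT hTc hF ?_ hz
      (by simpa using hz')
    filter_upwards [ae_forall_of_lipschitzOn hφ hD] with y hy hyT hFy
    obtain ⟨hd, hrank, hsurj⟩ := hy (g y) (hgB hyT) (hφg y hyT)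
    have hφd := hasFDerivAt_straighten (hpn := hpn) (hpm := hpm) hd
    -- Differentiability of g at y is not known, so the chain rule is applied to f = (f ∘ g) ∘ φ
    -- near g y instead.
    have hcomp : HasFDerivAt (fun x => f (g (straighten hpn hpm f x)))
        ((fderiv ℝ (fun z => f (g z)) y).comp (complete hpn hpm (fderiv ℝ f (g y)))) (g y) := by
      refine HasFDerivAt.comp (g := fun z => f (g z)) (g y) ?_ hφd
      rw [hφg y hyT]
      exact hFy.hasFDerivAt
    have heq : (fun x => f (g (straighten hpn hpm f x))) =ᶠ[𝓝 (g y)] f := by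
      have h1 : ∀ᶠ x in 𝓝 (g y), straighten hpn hpm f x ∈ T :=
        hφd.continuousAt.eventually_mem (hT.mem_nhds (by rwa [hφg y hyT]))
      filter_upwards [h1, hB.mem_nhds (hgB hyT)] with x hxT hxB
      rw [hgφ x hxB hxT]
    have hfd := (hcomp.congr_of_eventuallyEq heq.symm).fderiv
    obtain ⟨u, hu⟩ := hsurj (z' - z)
    have hu0 : fderiv ℝ f (g y) u = 0 :=
      apply_eq_zero_of_res_complete hpn hpm hrank hsurj (by rw [hu, map_sub, h, sub_self])
    have : fderiv ℝ (fun z => f (g z)) y (z' - z) = fderiv ℝ f (g y) u := by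
      conv_rhs => rw [hfd]
      rw [ContinuousLinearMap.comp_apply, hu]
    rw [this, hu0, inner_zero_right]
  rw [add_sub_cancel] at key
  have := key (-(f (g z') - f (g z)))
  rw [inner_neg_left, real_inner_self_eq_norm_sq] at this
  have h0 : ‖f (g z') - f (g z)‖ = 0 := by
    nlinarith [norm_nonneg (f (g z') - f (g z))]
  exact (sub_eq_zero.1 (norm_eq_zero.1 h0)).symm

end Factor

end LipschitzRank

/-! ### The rank theorem -/

theorem theorem3p3 {n m p : ℕ} (hpn : p ≤ n) (hpm : p ≤ m)
    (f : EuclideanSpace ℝ (Fin n) → EuclideanSpace ℝ (Fin m))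
    (x₀ : EuclideanSpace ℝ (Fin n)) (U : Set (EuclideanSpace ℝ (Fin n))) (hU : U ∈ 𝓝 x₀)
    (K : ℝ) (hK : 0 < K) (hf : LipschitzRank.LipBound f U K)
    (hrank : ∀ x ∈ U, LipschitzRank.OfRank (LipschitzRank.genJacobian f x) p)
    (hblock : LipschitzRank.OfRank (LipschitzRank.genJacobianBlock hpn hpm f x₀) p)
    (δ : ℝ) (hδ : δ = LipschitzRank.blockDelta (LipschitzRank.genJacobianBlock hpn hpm f x₀) K)
    (r : ℝ) (hr : 0 < r) (hrU : ball x₀ r ⊆ U)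
    (hrδ : ∀ x ∈ ball x₀ r, LipschitzRank.genJacobian f x ⊆
      LipschitzRank.genJacobian f x₀ + closedBall (0 : Matrix (Fin m) (Fin n) ℝ) δ)
    (ρ₁ ρ₂ : ℝ) (hρ₁ : ρ₁ = r * δ / (2 * (K + 1))) (hρ₂ : ρ₂ = r * δ / 2) :
    ∃ (φ : OpenPartialHomeomorph (EuclideanSpace ℝ (Fin n)) (EuclideanSpace ℝ (Fin n)))
      (ψ : OpenPartialHomeomorph (EuclideanSpace ℝ (Fin m)) (EuclideanSpace ℝ (Fin m))),
      ball x₀ ρ₁ ⊆ φ.source ∧ φ.source ⊆ ball x₀ r ∧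
      φ.target = ball (φ x₀) ρ₂ ∧
      LipschitzRank.LipBound φ φ.source (K + 1) ∧
      LipschitzRank.LipBound φ.symm φ.target (1 / δ) ∧
      ball (f x₀) ρ₂ ⊆ ψ.source ∧ MapsTo f φ.source ψ.source ∧
      LipschitzRank.LipBound ψ ψ.source (1 + K / δ) ∧
      (∃ C : ℝ, LipschitzRank.LipBound ψ.symm ψ.target C) ∧
      ∀ z ∈ ball (φ x₀) ρ₂, ∀ j : Fin m,
        ψ (f (φ.symm z)) j = if h : (j : ℕ) < p then z ⟨j, lt_of_lt_of_le h hpn⟩ else 0 := by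
  open LipschitzRank in
  have hcomp := hf.isCompact_genJacobian hK.le hU
  have hne := hf.genJacobian_nonempty hK.le hU
  have hδ0 : 0 < δ := by
    rw [hδ]
    refine blockDelta_pos (hcomp.image ?_) (hne.image _) hblock K
    exact continuous_id.matrix_submatrix _ _
  -- Every term of the infimum is at most 1; this serves to place the ρ₁-ball inside the r-ball.
  have hδle : δ ≤ 1 / 2 := by
    obtain ⟨M, hM⟩ := hne
    have h1 := blockDelta_le K (S := genJacobianBlock hpn hpm f x₀) (mem_image_of_mem _ hM)
    rw [← hδ] at h1
    have h2 : 1 / Real.sqrt (1 + (1 + K) ^ 2 *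
        ‖(M.submatrix (Fin.castLE hpm) (Fin.castLE hpn))⁻¹‖ ^ 2) ≤ 1 := by
      rw [div_le_one (by positivity), Real.one_le_sqrt]
      exact le_add_of_nonneg_right (by positivity)
    linarith
  set S := (fun M => complete hpn hpm (matrixCLM M)) '' genJacobian f x₀
  have hSδ : ∀ A ∈ S, ∀ v, 2 * δ * ‖v‖ ≤ ‖A v‖ := by
    rintro _ ⟨M, hM, rfl⟩ v
    have hMb : M.submatrix (Fin.castLE hpm) (Fin.castLE hpn) ∈ genJacobianBlock hpn hpm f x₀ :=
      mem_image_of_mem _ hM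
    have h1 := blockDelta_le K hMb
    have h2 := norm_le_mul_norm_complete hpn hpm
      (mem_closedBall_zero_iff.1 (hf.genJacobian_subset hK.le hU hM)) rfl
      (isUnit_det_of_rank_eq (hblock _ hMb)) v
    rw [← hδ] at h1
    rw [← div_le_iff₀' (by positivity), div_eq_mul_one_div, mul_comm] at h2
    exact (mul_le_mul_of_nonneg_right h1 (norm_nonneg v)).trans h2
  set B := ball x₀ r
  have hfB : LipBound f B K := fun x hx y hy => hf x (hrU hx) y (hrU hy)
  have hfl := hfB.lipschitzOnWith hK.le
  set φ := straighten hpn hpm f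
  have hφB : LipBound φ B (K + 1) := hfB.straighten
  have hφl := hφB.lipschitzOnWith (by positivity)
  have hdiff : ∀ x ∈ B, DifferentiableAt ℝ f x → ∃ A ∈ S, ‖fderiv ℝ φ x - A‖ ≤ δ := by
    intro x hx hd
    obtain ⟨M, hM, N, hN, hMN⟩ := mem_add.1 (hrδ x hx (jacobian_mem_genJacobian hd))
    refine ⟨_, ⟨M, hM, rfl⟩, ?_⟩
    rw [(hasFDerivAt_straighten hd).fderiv, ← matrixCLM_jacobian, ← hMN]
    refine (norm_complete_sub_le _ _ _ _).trans ?_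
    rw [← map_sub, add_sub_cancel_left, norm_matrixCLM]
    exact mem_closedBall_zero_iff.1 hN
  let μ : MeasureTheory.Measure (EuclideanSpace ℝ (Fin n)) :=
    MeasureTheory.Measure.hausdorffMeasure (Module.finrank ℝ (EuclideanSpace ℝ (Fin n)))
  have hae : ∀ᵐ x ∂μ, x ∈ B → DifferentiableAt ℝ f x := by
    filter_upwards [hfl.ae_differentiableWithinAt_of_mem (μ := μ)] with x hx hxB
    exact (hx hxB).differentiableAt (isOpen_ball.mem_nhds hxB)
  have hD : ∀ᵐ x ∂μ, x ∈ B → ∃ A ∈ S, ‖fderiv ℝ φ x - A‖ ≤ δ :=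
    hae.mono fun x hx hxB => hdiff x hxB (hx hxB)
  have hSc : Convex ℝ S := convex_image_complete hpn hpm (convex_convexHull ℝ _)
  have hSne : S.Nonempty := hne.image _
  have hlow : ∀ x ∈ B, ∀ y ∈ B, δ * ‖x - y‖ ≤ ‖φ x - φ y‖ := fun x hx y hy =>
    mul_norm_sub_le_of_fderiv_near hSc hSne hδ0 hSδ hφl hD hx hy
  have hinj : InjOn φ B := by
    intro x hx y hy hxy
    have h1 := hlow x hx y hy
    rw [hxy, sub_self, norm_zero] at h1
    exact sub_eq_zero.1 (norm_le_zero_iff.1 (nonpos_of_mul_nonpos_right h1 hδ0))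
  set T := ball (φ x₀) ρ₂ with hT
  have hTB : T ⊆ φ '' B := by
    rw [hT, hρ₂]
    exact ball_subset_image_of_fderiv_near hSc hSne hδ0 hSδ hφl hD
  let g := Function.invFunOn φ B
  have hgB : MapsTo g T B := fun z hz => Function.invFunOn_mem (hTB hz)
  have hφg : ∀ z ∈ T, φ (g z) = z := fun z hz => Function.invFunOn_eq (hTB hz)
  have hgφ : ∀ x ∈ B, g (φ x) = x := fun x hx => hinj.leftInvOn_invFunOn hx
  have hgT : LipBound g T (1 / δ) := by
    intro z hz z' hz'
    have h1 := hlow _ (hgB hz) _ (hgB hz')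
    rw [hφg z hz, hφg z' hz'] at h1
    rw [one_div_mul_eq_div, le_div_iff₀' hδ0]
    exact h1
  have hF : LipBound (fun z => f (g z)) T (K / δ) := by
    intro z hz z' hz'
    refine (hfB _ (hgB hz) _ (hgB hz')).trans ?_
    calc K * ‖g z - g z'‖ ≤ K * (1 / δ * ‖z - z'‖) := by gcongr; exact hgT z hz z' hz'
      _ = K / δ * ‖z - z'‖ := by ring
  have hresF : ∀ z ∈ T, res hpm (f (g z)) = res hpn z := by
    intro z hz
    rw [← res_straighten (hpn := hpn) (f := f)]
    exact congrArg _ (hφg z hz)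
  have hgood : ∀ᵐ x ∂μ, x ∈ B → DifferentiableAt ℝ f x ∧
      Module.finrank ℝ (LinearMap.range (fderiv ℝ f x).toLinearMap) = p ∧
      Function.Surjective (complete hpn hpm (fderiv ℝ f x)) := by
    refine hae.mono fun x hx hxB => ⟨hx hxB, ?_, ?_⟩
    · rw [← matrixCLM_jacobian, finrank_range_matrixCLM]
      exact hrank x (hrU hxB) _ (jacobian_mem_genJacobian (hx hxB))
    -- A perturbation of size δ leaves the lower bound 2δ − δ = δ.
    · obtain ⟨A, hA, hAd⟩ := hdiff x hxB (hx hxB)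
      rw [(hasFDerivAt_straighten (hx hxB)).fderiv] at hAd
      refine surjective_of_mul_norm_le hδ0 fun v => ?_
      have h1 := hSδ A hA v
      have h2 := (complete hpn hpm (fderiv ℝ f x) - A).le_of_opNorm_le hAd v
      rw [_root_.sub_apply, norm_sub_rev] at h2
      linarith [norm_sub_norm_le (A v) (complete hpn hpm (fderiv ℝ f x) v)]
  have hdep : ∀ z ∈ T, ∀ z' ∈ T, res hpn z = res hpn z' → f (g z) = f (g z') :=
    fun z hz z' hz' h => eq_of_res_eq (hpm := hpm) isOpen_ball isOpen_ball (convex_ball _ _) hφl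
      hgB hφg (fun x hx _ => hgφ x hx) (hF.lipschitzOnWith (by positivity)) hgood hz hz' h
  obtain ⟨ψ, hψs, hψ, hψ', hψF⟩ := exists_shear hpn hpm (by positivity) hF hresF hdep
  have hresx₀ : res hpn (φ x₀) = res hpm (f x₀) := res_straighten x₀
  let Φ : OpenPartialHomeomorph (EuclideanSpace ℝ (Fin n)) (EuclideanSpace ℝ (Fin n)) :=
    { toFun := φ
      invFun := g
      source := B ∩ φ ⁻¹' T
      target := T
      map_source' := fun x hx => hx.2
      map_target' := fun z hz => ⟨hgB hz, by rwa [mem_preimage, hφg z hz]⟩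
      left_inv' := fun x hx => hgφ x hx.1
      right_inv' := hφg
      open_source := hφl.continuousOn.isOpen_inter_preimage isOpen_ball isOpen_ball
      open_target := isOpen_ball
      continuousOn_toFun := hφl.continuousOn.mono inter_subset_left
      continuousOn_invFun := (hgT.lipschitzOnWith (by positivity)).continuousOn }
  refine ⟨Φ, ψ, ?_, inter_subset_left, rfl, fun x hx y hy => hφB x hx.1 y hy.1, hgT, ?_, ?_, hψ,
    ⟨_, hψ'⟩, ?_⟩
  -- ρ₁ is chosen so that the (K + 1)-Lipschitz map φ sends the ρ₁-ball into the target ball.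
  · have hρ : (K + 1) * ρ₁ = ρ₂ := by
      rw [hρ₁, hρ₂]
      field_simp
    have hρr : ρ₁ ≤ r := by
      rw [hρ₁, div_le_iff₀ (by positivity)]
      nlinarith
    intro x hx
    have hxB : x ∈ B := ball_subset_ball hρr hx
    refine ⟨hxB, ?_⟩
    rw [mem_ball, dist_eq_norm] at hx
    rw [mem_preimage, hT, mem_ball, dist_eq_norm, ← hρ]
    exact (hφB x hxB x₀ (mem_ball_self hr)).trans_lt (by gcongr)
  -- The source of ψ is the cylinder over the p-dimensional ρ₂-ball about the first p coordinates
  -- shared by φ x₀ and f x₀.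
  · intro y hy
    rw [hψs, mem_preimage, hresx₀, mem_ball, dist_eq_norm, ← map_sub]
    rw [mem_ball, dist_eq_norm] at hy
    exact (norm_res_le _ _).trans_lt hy
  · intro x hx
    have h1 : φ x ∈ ball (φ x₀) ρ₂ := hx.2
    rw [hψs, mem_preimage, ← res_straighten (hpn := hpn) (f := f), mem_ball, dist_eq_norm,
      ← map_sub]
    rw [mem_ball, dist_eq_norm] at h1
    exact (norm_res_le _ _).trans_lt h1
  · intro z hz j
    have h1 : ψ (f (Φ.symm z)) = pad hpm (res hpn z) := hψF z hz
    rw [h1]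
    rfl
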